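/- **Lemma 1.11.** Let $\mathcal T$ be a big tt-category, i.e. a triangulated category with suspension $\Sigma$, with a symmetric monoidal product $\otimes$ with unit $\mathbf 1$, such that - $\mathcal T$ has small coproducts, the subcategory $\mathcal T^c$ of compact objects is skeletally small, and an object $X$ with $\mathrm{Hom}(c,X)=0$ for all $c\in\mathcal T^c$ is zero; - $\otimes$ is exact and preserves small coproducts in each variable, and $\mathbf 1\in\mathcal T^c$; - the compact objects are exactly the rigid ones, i.e. the objects $X$ for which $X\otimes-$ has a right adjoint $[X,-]$ (internal Hom) and the natural map $[X,\mathbf 1]\otimes Y\to[X,Y]$ is an isomorphism for all $Y$. Let $(\mathcal T^{\le 0},\mathcal T^{>0})$ be a fixed t-structure on $\mathcal T$, with $\mathcal T^{\le n}=\Sigma^{-n}\mathcal T^{\le 0}$ and $\mathcal T^{>n}=\Sigma^{-n}\mathcal T^{>0}$, which is compactly generated and nondegenerate ($\bigcap_n\mathcal T^{\le n}=0=\bigcap_n\mathcal T^{>n}$) and satisfies $\mathbf 1\in\mathcal T^{\le 0}$ and $\mathcal T^{\le 0}\otimes\mathcal T^{\le 0}\subseteq\mathcal T^{\le 0}$.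 Here a t-structure $(\mathcal U,\mathcal V)$ (aisle $\mathcal U$, coaisle $\mathcal V$) is *compactly generated* if $\mathcal V=\{X:\mathrm{Hom}(c,X)=0\ \forall c\in\mathcal U\cap\mathcal T^c\}$, and it is a *$\otimes$-t-structure* if $\mathcal T^{\le 0}\otimes\mathcal U\subseteq\mathcal U$. The *$\otimes$-t-structure generated by* a class $\mathcal S$ of objects is the $\otimes$-t-structure whose aisle is the smallest among the aisles of $\otimes$-t-structures that contain $\mathcal S$. For a subcategory $\mathcal X$ of $\mathcal T$, the *semi-Bousfield class* of $\mathcal X$ is $|\mathcal X\rangle=\{Y\in\mathcal T: X\otimes Y\in\mathcal T^{>0}\ \forall X\in\mathcal X\}$. Then, for every subcategory $\mathcal S$ of $\mathcal T^c$ and every subcategory $\mathcal V$ of $\mathcal T$, the following are equivalent: 1. the $\otimes$-t-structure generated by $\mathcal S$ exists, is compactly generated, and has coaisle $\mathcal V$; 2. $\mathcal V=\{X\in\mathcal T:[S,X]\in\mathcal T^{>0}\ \forall S\in\mathcal S\}$; 3. $\mathcal V=|\mathcal S^*\rangle$, where $\mathcal S^*=\{S^*:S\in\mathcal S\}$ and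 $S^*=[S,\mathbf 1]$. (In particular, taking $\mathcal V$ as in 2, the $\otimes$-t-structure generated by $\mathcal S$ always exists and is compactly generated.) Moreover, the coaisle of every compactly generated $\otimes$-t-structure on $\mathcal T$ is a semi-Bousfield class. -/

import Mathlib

open CategoryTheory CategoryTheory.Limits CategoryTheory.MonoidalCategory
open CategoryTheory.Triangulated

universe v u

namespace BigTT

section

variable {C : Type u} [Category.{v} C]

/-- An object `X` of a preadditive category is compact if `Hom(X, -)`, with values in abelian
groups, preserves small coproducts. -/
def IsCompact [Preadditive C] : ObjectProperty C := fun X =>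
  ∀ J : Type v, PreservesColimitsOfShape (Discrete J) (preadditiveCoyoneda.obj (Opposite.op X))

/-- The natural map `[X, 𝟙] ⊗ Y ⟶ [X, Y]`, adjoint to
`X ⊗ ([X, 𝟙] ⊗ Y) ≅ (X ⊗ [X, 𝟙]) ⊗ Y ⟶ 𝟙 ⊗ Y ≅ Y`, for an object `X` such that `X ⊗ -` has
a right adjoint `[X, -]`. -/
noncomputable def dualTensorToIhom [MonoidalCategory C] (X : C) [Closed X] (Y : C) :
    (ihom X).obj (𝟙_ C) ⊗ Y ⟶ (ihom X).obj Y :=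
  MonoidalClosed.curry
    ((α_ X ((ihom X).obj (𝟙_ C)) Y).inv ≫ ((ihom.ev X).app (𝟙_ C) ▷ Y) ≫ (λ_ Y).hom)

/-- An object `X` is rigid if the functor `X ⊗ -` has a right adjoint `[X, -]` and the natural
map `[X, 𝟙] ⊗ Y ⟶ [X, Y]` is an isomorphism for every `Y`. The condition does not depend on the
choice of the right adjoint. -/
def IsRigid [MonoidalCategory C] : ObjectProperty C := fun X =>
  ∃ _ : Closed X, ∀ Y : C, IsIso (dualTensorToIhom X Y)

end

section

variable (C : Type u) [Category.{v} C] [Preadditive C] [HasZeroObject C] [HasShift C ℤ]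
  [∀ n : ℤ, (shiftFunctor C n).Additive] [Pretriangulated C]
  [MonoidalCategory C] [SymmetricCategory C]

/-- A triangulated category with a symmetric monoidal structure is a big tt-category (a
rigidly-compactly generated tensor triangulated category) if it is compactly generated, the tensor
product is exact and preserves coproducts in each variable (one variable is enough, by symmetry),
the unit is compact, and compact objects are the same as rigid objects.

That all internal homs exist is a consequence (Brown representability), and is not assumed: the
internal homs out of compact objects are provided by rigidity. -/
structure IsBigTT : Prop where
  /-- the octahedral axiom -/
  isTriangulated : IsTriangulated C
  /-- all small coproducts exist -/
  hasCoproducts : HasCoproducts.{v} C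
  /-- the subcategory of compact objects is skeletally small -/
  essentiallySmall_compact : ObjectProperty.EssentiallySmall.{v} (IsCompact (C := C))
  /-- the compact objects generate -/
  isZero_of_compact : ∀ X : C, (IsCompact (C := C)).rightOrthogonal X → IsZero X
  /-- `X ⊗ -` is exact, that is, a triangulated functor -/
  tensor_exact : ∀ X : C, ∃ _ : (tensorLeft X).CommShift ℤ, (tensorLeft X).IsTriangulated
  /-- `X ⊗ -` preserves small coproducts -/
  tensor_coproducts : ∀ (X : C) (J : Type v),
    PreservesColimitsOfShape (Discrete J) (tensorLeft X)
  /-- the unit is compact -/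
  compact_unit : IsCompact (𝟙_ C)
  /-- compact and rigid objects coincide -/
  compact_iff_rigid : ∀ X : C, IsCompact X ↔ IsRigid X

end

section

variable {C : Type u} [Category.{v} C] [Preadditive C] [HasZeroObject C] [HasShift C ℤ]
  [∀ n : ℤ, (shiftFunctor C n).Additive] [Pretriangulated C]

/-- The aisle of a t-structure. -/
def aisle (τ : TStructure C) : ObjectProperty C := τ.le 0

/-- The coaisle of a t-structure, i.e. the objects in (cohomological) degrees `> 0`. -/
def coaisle (τ : TStructure C) : ObjectProperty C := τ.ge 1

/-- A t-structure is compactly generated if its coaisle is the right orthogonal of the compact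
objects of its aisle. -/
def IsCompactlyGenerated (τ : TStructure C) : Prop :=
  coaisle τ = (aisle τ ⊓ IsCompact).rightOrthogonal

/-- A t-structure is nondegenerate if `0` is the only object in all `T^{≤ n}`, and the only object
in all `T^{> n}`. -/
def IsNondegenerate (τ : TStructure C) : Prop :=
  (∀ X : C, (∀ n : ℤ, τ.le n X) → IsZero X) ∧ (∀ X : C, (∀ n : ℤ, τ.ge n X) → IsZero X)

variable [MonoidalCategory C]

/-- A big ttt-category: a big tt-category with a fixed t-structure `t = (T^{≤ 0}, T^{> 0})` that is
compactly generated, nondegenerate, and such that `T^{≤ 0}` contains the unit and is closed under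
the tensor product. -/
structure IsBigTTT [SymmetricCategory C] (t : TStructure C) : Prop where
  isBigTT : IsBigTT C
  isCompactlyGenerated : IsCompactlyGenerated t
  isNondegenerate : IsNondegenerate t
  unit_mem : aisle t (𝟙_ C)
  tensor_mem : ∀ X Y : C, aisle t X → aisle t Y → aisle t (X ⊗ Y)

/-- `τ` is a `⊗`-t-structure, relative to the fixed t-structure `t`: `T^{≤ 0} ⊗ U ⊆ U` for the
aisle `U` of `τ`. -/
def IsTensorTStructure (t τ : TStructure C) : Prop :=
  ∀ X U : C, aisle t X → aisle τ U → aisle τ (X ⊗ U)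

/-- `τ` is the `⊗`-t-structure generated by `S`: the `⊗`-t-structure with the smallest aisle among
the `⊗`-t-structures whose aisle contains `S`. -/
structure IsTensorGeneratedBy (t : TStructure C) (S : ObjectProperty C) (τ : TStructure C) :
    Prop where
  isTensor : IsTensorTStructure t τ
  subset_aisle : S ≤ aisle τ
  minimal : ∀ τ' : TStructure C, IsTensorTStructure t τ' → S ≤ aisle τ' → aisle τ ≤ aisle τ'

/-- The semi-Bousfield class `|𝒳⟩ = {Y : X ⊗ Y ∈ T^{> 0} for all X ∈ 𝒳}`. -/
def semiBousfieldClass (t : TStructure C) (𝒳 : ObjectProperty C) : ObjectProperty C := fun Y =>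
  ∀ X : C, 𝒳 X → coaisle t (X ⊗ Y)

/-- A subcategory is a semi-Bousfield class if it is `|𝒳⟩` for some subcategory `𝒳`. -/
def IsSemiBousfieldClass (t : TStructure C) (V : ObjectProperty C) : Prop :=
  ∃ 𝒳 : ObjectProperty C, V = semiBousfieldClass t 𝒳

/-- The class `{X : [s, X] ∈ T^{> 0} for all s ∈ S}`, where `[s, -]` is the right adjoint of
`s ⊗ -`. It is used for classes `S` of compact objects of a big tt-category, where the right
adjoint exists by rigidity; the condition does not depend on its choice. -/
def ihomClass (t : TStructure C) (S : ObjectProperty C) : ObjectProperty C := fun X =>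
  ∀ s : C, S s → ∃ _ : Closed s, coaisle t ((ihom s).obj X)

/-- The class `S^* = {s^* : s ∈ S}` (closed under isomorphisms), where `s^* = [s, 𝟙]`. It is used
for classes `S` of compact objects of a big tt-category. -/
def dualClass (S : ObjectProperty C) : ObjectProperty C := fun D =>
  ∃ (s : C) (_ : S s) (_ : Closed s), Nonempty (D ≅ (ihom s).obj (𝟙_ C))

end

end BigTT

/-! Let `G` be the class of objects `c ⊗ s` with `c` compact in `T^{≤ 0}` and `s` in `S`. Since `t`
is compactly generated, `[s, Y]` lies in `T^{> 0}` iff `Hom(c ⊗ s, Y) = 0` for all such `c`; since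
`s` is rigid, `s^* ⊗ Y ≅ [s, Y]`. So the classes in 2 and 3 are both the right orthogonal of `G`,
and it remains to see that this is the coaisle of the `⊗`-t-structure generated by `S`.

The class `G` is essentially small, closed under suspension and made of compact objects, so it
generates a t-structure. The truncation triangle `U ⟶ X ⟶ V ⟶` comes from `exists_approximation`:
all maps from `G` are killed repeatedly, and `V` is the telescope. That theorem also shows that, for
`F` exact and coproduct-preserving, `Hom(F U, Y) = 0` as soon as `Hom(F g, Y) = 0` for all `g` in
`G`. Applied to tensor functors and to the generators of `T^{≤ 0}`, this reduces the `⊗`-property of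
the aisle to compact objects, where it follows by adjunction. Minimality holds because any `⊗`-aisle
containing `S` contains `G`.

For the last claim, a compactly generated `⊗`-t-structure is generated by the compact objects of its
aisle. -/

namespace BigTT

open Pretriangulated

/-! ### Maps from compact objects into coproducts -/

section Compact

variable {C : Type u} [Category.{v} C] [Preadditive C]

/-- A subgroup of `Hom(g, ∐ X)` containing the morphisms which factor through one of the
summands is everything, if `g` is compact. -/
lemma mem_of_preservesColimit {J : Type*} {X : J → C} {c : Cofan X} (hc : IsColimit c) (g : C)
    [PreservesColimitsOfShape (Discrete J) (preadditiveCoyoneda.obj (Opposite.op g))]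
    (S : AddSubgroup (g ⟶ c.pt)) (hS : ∀ (j : J) (k : g ⟶ X j), k ≫ c.inj j ∈ S)
    (f : g ⟶ c.pt) : f ∈ S := by
  -- The projection to the quotient by `S` vanishes on each summand of `Hom(g, ∐ X) = ∐ Hom(g, X
  -- j)`, hence vanishes.
  have h : AddCommGrpCat.ofHom (QuotientAddGroup.mk' S) = 0 :=
    (isColimitOfPreserves (preadditiveCoyoneda.obj (Opposite.op g)) hc).hom_ext fun ⟨j⟩ => by
      ext k
      exact (QuotientAddGroup.eq_zero_iff _).2 (hS j k)
  exact (QuotientAddGroup.eq_zero_iff _).1 (ConcreteCategory.congr_hom h f)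

/-- A morphism from a compact object to a coproduct vanishes if all its components vanish. -/
lemma eq_zero_of_comp_proj_eq_zero {J : Type*} [DecidableEq J] {X : J → C} {c : Cofan X}
    (hc : IsColimit c) (π : ∀ j, c.pt ⟶ X j) (hπ : ∀ j, c.inj j ≫ π j = 𝟙 _)
    (hπ' : ∀ i j, i ≠ j → c.inj i ≫ π j = 0) (g : C)
    [PreservesColimitsOfShape (Discrete J) (preadditiveCoyoneda.obj (Opposite.op g))]
    (f : g ⟶ c.pt) (hf : ∀ j, f ≫ π j = 0) : f = 0 := by
  -- The maps that are finite sums of their components. Quantifying over all `t ⊇ s` makes closure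
  -- under addition immediate.
  let S : AddSubgroup (g ⟶ c.pt) :=
    { carrier := {f | ∃ s : Finset J, ∀ t, s ⊆ t → f = ∑ j ∈ t, f ≫ π j ≫ c.inj j}
      zero_mem' := ⟨∅, by simp⟩
      add_mem' := by
        rintro a b ⟨s, hs⟩ ⟨t, ht⟩
        refine ⟨s ∪ t, fun r hr => ?_⟩
        simp only [Preadditive.add_comp, Finset.sum_add_distrib]
        rw [← hs r (Finset.union_subset_left hr), ← ht r (Finset.union_subset_right hr)]
      neg_mem' := by
        rintro a ⟨s, hs⟩
        refine ⟨s, fun r hr => ?_⟩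
        simp only [Preadditive.neg_comp, Finset.sum_neg_distrib]
        rw [← hs r hr] }
  obtain ⟨s, hs⟩ := mem_of_preservesColimit hc g S (fun j k => by
    refine ⟨{j}, fun t ht => ?_⟩
    rw [Finset.sum_eq_single j]
    · rw [Category.assoc, reassoc_of% (hπ j)]
    · intro i _ hij
      rw [Category.assoc, reassoc_of% (hπ' j i hij.symm), zero_comp, comp_zero]
    · intro hj
      exact (hj (ht (by simp))).elim) f
  rw [hs s subset_rfl]
  exact Finset.sum_eq_zero fun j _ => by rw [← Category.assoc, hf j, zero_comp]

lemma IsCompact.preservesColimitsOfShape_nat {g : C} (hg : IsCompact g) :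
    PreservesColimitsOfShape (Discrete ℕ) (preadditiveCoyoneda.obj (Opposite.op g)) :=
  have := hg (ULift.{v} ℕ)
  preservesColimitsOfShape_of_equiv (Discrete.equivalence Equiv.ulift) _

end Compact

/-! ### Exactness of `Hom(-, W)` on triangles -/

section YonedaExact

variable {D : Type*} [Category* D] [Preadditive D] [HasZeroObject D] [HasShift D ℤ]
  [∀ n : ℤ, (shiftFunctor D n).Additive] [Pretriangulated D]
  {X Y Z W : D} {f : X ⟶ Y} {g : Y ⟶ Z} {h : Z ⟶ X⟦(1 : ℤ)⟧}

lemma exists_eq_mor₂_comp (hT : Triangle.mk f g h ∈ distTriang D) (k : Y ⟶ W) (hk : f ≫ k = 0) :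
    ∃ l : Z ⟶ W, k = g ≫ l :=
  Triangle.yoneda_exact₂ _ hT k hk

lemma exists_eq_mor₃_comp_map (hT : Triangle.mk f g h ∈ distTriang D) (k : Z ⟶ W⟦(1 : ℤ)⟧)
    (hk : g ≫ k = 0) : ∃ l : X ⟶ W, k = h ≫ l⟦(1 : ℤ)⟧' := by
  obtain ⟨l', hl'⟩ := Triangle.yoneda_exact₃ _ hT k hk
  obtain ⟨l, rfl⟩ := (shiftFunctor D (1 : ℤ)).map_surjective l'
  exact ⟨l, hl'⟩

lemma exists_eq_mor₁_comp (hT : Triangle.mk f g h ∈ distTriang D) (k : X ⟶ W)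
    (hk : h ≫ k⟦(1 : ℤ)⟧' = 0) : ∃ l : Y ⟶ W, k = f ≫ l := by
  obtain ⟨l', hl'⟩ : ∃ l' : Y⟦(1 : ℤ)⟧ ⟶ W⟦(1 : ℤ)⟧, k⟦(1 : ℤ)⟧' = (-f⟦(1 : ℤ)⟧') ≫ l' :=
    exists_eq_mor₂_comp (rot_of_distTriang _ (rot_of_distTriang _ hT)) _ hk
  obtain ⟨l, rfl⟩ := (shiftFunctor D (1 : ℤ)).map_surjective l'
  refine ⟨-l, (shiftFunctor D (1 : ℤ)).map_injective ?_⟩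
  rw [hl', Preadditive.comp_neg, Functor.map_neg, Functor.map_comp, Preadditive.neg_comp]

end YonedaExact

/-! ### Maps out of a telescope -/

section Telescope

variable {D : Type*} [Category* D] [Preadditive D] [HasZeroObject D] [HasShift D ℤ]
  [∀ n : ℤ, (shiftFunctor D n).Additive] [Pretriangulated D]
  {Z : ℕ → D} {a : ∀ n, Z n ⟶ Z (n + 1)} {c : Cofan Z}
  {φ : c.pt ⟶ c.pt} {V : D} {p : c.pt ⟶ V} {d : V ⟶ c.pt⟦(1 : ℤ)⟧} {Y : D}

lemma exists_extension_telescope (hc : IsColimit c)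
    (hφ : ∀ n, c.inj n ≫ φ = c.inj n - a n ≫ c.inj (n + 1))
    (hT : Triangle.mk φ p d ∈ distTriang D)
    (hsurj : ∀ n (f : Z n ⟶ Y), ∃ f', f = a n ≫ f') (f : Z 0 ⟶ Y) :
    ∃ f' : V ⟶ Y, f = c.inj 0 ≫ p ≫ f' := by
  choose e he using hsurj
  let k : ∀ n, Z n ⟶ Y := fun n => Nat.rec f (fun n k => e n k) n
  have hk : ∀ n, k n = a n ≫ k (n + 1) := fun n => he n (k n)
  have hι : ∀ n, c.inj n ≫ Cofan.IsColimit.desc hc k = k n := fun n =>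
    Cofan.IsColimit.fac hc k n
  obtain ⟨f', hf'⟩ := exists_eq_mor₂_comp hT (Cofan.IsColimit.desc hc k)
    (Cofan.IsColimit.hom_ext hc _ _ fun n => by
      rw [← Category.assoc, hφ, Preadditive.sub_comp, Category.assoc, hι, hι, ← hk, sub_self,
        comp_zero])
  exact ⟨f', by rw [← hf']; exact (hι 0).symm⟩

/-- A Milnor sequence argument: by injectivity `f` vanishes on every `Z n`, so it comes from the
`lim¹` term of the groups `Hom(Z n, Y)`, which is zero because the transition maps are surjective.
-/
lemma eq_zero_of_telescope (hc : IsColimit c)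
    (hφ : ∀ n, c.inj n ≫ φ = c.inj n - a n ≫ c.inj (n + 1))
    (hT : Triangle.mk φ p d ∈ distTriang D)
    (hsurj : ∀ n (f : Z n ⟶ Y), ∃ f', f = a n ≫ f')
    (hinj : ∀ n (f : Z (n + 1) ⟶ Y⟦(1 : ℤ)⟧), a n ≫ f = 0 → f = 0)
    (f : V ⟶ Y⟦(1 : ℤ)⟧) (hf : c.inj 0 ≫ p ≫ f = 0) : f = 0 := by
  have hφp : φ ≫ p = 0 := comp_distTriang_mor_zero₁₂ _ hT
  have hdφ : d ≫ φ⟦(1 : ℤ)⟧' = 0 := comp_distTriang_mor_zero₃₁ _ hT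
  have hp : ∀ n, c.inj n ≫ p = a n ≫ c.inj (n + 1) ≫ p := fun n => by
    have := congr($(hφ n) ≫ p)
    rw [Category.assoc, hφp, comp_zero, Preadditive.sub_comp, Category.assoc] at this
    exact sub_eq_zero.1 this.symm
  have hpf : ∀ n, c.inj n ≫ p ≫ f = 0 := fun n => by
    induction n with
    | zero => exact hf
    | succ n ih =>
      refine hinj n _ ?_
      rw [← ih, ← Category.assoc (c.inj n), hp]
      simp
  obtain ⟨h, hg⟩ := exists_eq_mor₃_comp_map hT f
    (Cofan.IsColimit.hom_ext hc _ _ fun n => by rw [comp_zero]; exact hpf n)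
  choose e he using hsurj
  -- Recursive solution of `k n - a n ≫ k (n + 1) = c.inj n ≫ h`, which exhibits `h` as a multiple
  -- of `φ`.
  let k : ∀ n, Z n ⟶ Y := fun n => Nat.rec 0 (fun n k => e n (k - c.inj n ≫ h)) n
  have hk : ∀ n, k n - c.inj n ≫ h = a n ≫ k (n + 1) := fun n => he n _
  have hι : ∀ n, c.inj n ≫ Cofan.IsColimit.desc hc k = k n := fun n =>
    Cofan.IsColimit.fac hc k n
  have hh : h = φ ≫ Cofan.IsColimit.desc hc k := Cofan.IsColimit.hom_ext hc _ _ fun n => by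
    rw [← Category.assoc, hφ, Preadditive.sub_comp, Category.assoc, hι, hι, ← hk,
      sub_sub_cancel]
  rw [hg, hh, Functor.map_comp, reassoc_of% hdφ, zero_comp]

end Telescope

/-! ### Approximation by a class of compact objects -/

section Approximation

variable {C : Type u} [Category.{v} C] [Preadditive C] [HasZeroObject C] [HasShift C ℤ]
  [∀ n : ℤ, (shiftFunctor C n).Additive] [Pretriangulated C]

/-- The morphism `a` kills all morphisms from objects of `G`, and its fiber is a coproduct of
objects of `G`. -/
structure IsKillingMap (G : ObjectProperty C) {X X' : C} (a : X ⟶ X') : Prop where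
  comp_eq_zero : ∀ ⦃g : C⦄, G g → ∀ f : g ⟶ X, f ≫ a = 0
  exists_triangle : ∃ (J : Type v) (Z : J → C) (c : Cofan Z) (_ : IsColimit c)
    (_ : ∀ j, G (Z j)) (i : c.pt ⟶ X) (d : X' ⟶ c.pt⟦(1 : ℤ)⟧),
      Triangle.mk i a d ∈ distTriang C

lemma exists_isKillingMap [HasCoproducts.{v} C] (G : ObjectProperty C)
    [ObjectProperty.EssentiallySmall.{v} G] (X : C) :
    ∃ (X' : C) (a : X ⟶ X'), IsKillingMap G a := by
  obtain ⟨Q, _, hQ, hGQ⟩ := ObjectProperty.EssentiallySmall.exists_small_le.{v} G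
  let J := Shrink.{v} (Subtype Q)
  let obj : J → C := fun j => ((equivShrink (Subtype Q)).symm j).1
  -- One summand for each map to `X` from a representative of an isomorphism class in `G`; the cone
  -- of the evaluation map `i` kills all these maps.
  let Z : (Σ j : J, (obj j ⟶ X)) → C := fun x => obj x.1
  let i : ∐ Z ⟶ X := Sigma.desc fun x => x.2
  obtain ⟨X', a, d, hT⟩ := distinguished_cocone_triangle i
  have hia : i ≫ a = 0 := comp_distTriang_mor_zero₁₂ _ hT
  refine ⟨X', a, ⟨fun g hg f => ?_, _, Z, _, coproductIsCoproduct Z, fun x => ?_, i, d, hT⟩⟩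
  · obtain ⟨q, hq, ⟨e⟩⟩ := hGQ _ hg
    obtain ⟨j, rfl⟩ : ∃ j, obj j = q := ⟨equivShrink (Subtype Q) ⟨q, hq⟩, by simp [obj]⟩
    have : f = e.hom ≫ Sigma.ι Z ⟨j, e.inv ≫ f⟩ ≫ i := by simp [i]
    rw [this]
    simp [hia]
  · exact hQ _ ((equivShrink (Subtype Q)).symm x.1).2

namespace IsKillingMap

variable {G : ObjectProperty C} {X X' : C} {a : X ⟶ X'} (ha : IsKillingMap G a)
  {D : Type*} [Category* D] [Preadditive D] [HasZeroObject D] [HasShift D ℤ]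
  [∀ n : ℤ, (shiftFunctor D n).Additive] [Pretriangulated D]
  (F : C ⥤ D) [F.CommShift ℤ] [F.IsTriangulated]
  (hF : ∀ J : Type v, PreservesColimitsOfShape (Discrete J) F)
  {Y : D} (hY : ∀ ⦃g : C⦄, G g → ∀ f : F.obj g ⟶ Y, f = 0)

include ha hF hY

lemma exists_map_triangle : ∃ (P : D) (i : P ⟶ F.obj X) (d : F.obj X' ⟶ P⟦(1 : ℤ)⟧),
    Triangle.mk i (F.map a) d ∈ distTriang D ∧ ∀ f : P ⟶ Y, f = 0 := by
  obtain ⟨J, Z, c, hc, hZ, i, d, hT⟩ := ha.exists_triangle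
  have := hF J
  exact ⟨_, _, _, F.map_distinguished _ hT, fun f =>
    (isColimitOfPreserves F hc).hom_ext fun ⟨j⟩ => (hY (hZ j) _).trans comp_zero.symm⟩

lemma exists_extension (f : F.obj X ⟶ Y) : ∃ f', f = F.map a ≫ f' := by
  obtain ⟨P, i, d, hT, hP⟩ := ha.exists_map_triangle F hF hY
  exact exists_eq_mor₂_comp hT f (hP _)

lemma eq_zero (f : F.obj X' ⟶ Y⟦(1 : ℤ)⟧) (hf : F.map a ≫ f = 0) : f = 0 := by
  obtain ⟨P, i, d, hT, hP⟩ := ha.exists_map_triangle F hF hY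
  obtain ⟨h, rfl⟩ := exists_eq_mor₃_comp_map hT f hf
  rw [hP h, Functor.map_zero, comp_zero]

end IsKillingMap

/-- Every object has an approximation by a class `G` of compact objects: a triangle
`U ⟶ X ⟶ V ⟶` such that `V` is right orthogonal to `G`, and `U` is generated by `G`. -/
theorem exists_approximation [HasCoproducts.{v} C] (G : ObjectProperty C)
    [ObjectProperty.EssentiallySmall.{v} G] (hG : G ≤ IsCompact) (X : C) :
    ∃ (U V : C) (i : U ⟶ X) (p : X ⟶ V) (d : V ⟶ U⟦(1 : ℤ)⟧),
      Triangle.mk i p d ∈ distTriang C ∧ G.rightOrthogonal V ∧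
      ∀ (F : C ⥤ C) [F.CommShift ℤ] [F.IsTriangulated],
        (∀ J : Type v, PreservesColimitsOfShape (Discrete J) F) →
        ∀ Y : C, (∀ ⦃g : C⦄, G g → ∀ f : F.obj g ⟶ Y, f = 0) → ∀ f : F.obj U ⟶ Y, f = 0 := by
  choose cone a ha using exists_isKillingMap G
  obtain ⟨Z, b, hb, rfl⟩ : ∃ (Z : ℕ → C) (b : ∀ n, Z n ⟶ Z (n + 1)),
      (∀ n, IsKillingMap G (b n)) ∧ Z 0 = X :=
    ⟨fun n => Nat.rec X (fun _ => cone) n, fun n => a _, fun n => ha _, rfl⟩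
  have : HasColimitsOfShape (Discrete ℕ) C :=
    hasColimitsOfShape_of_equivalence (Discrete.equivalence Equiv.ulift.{v})
  obtain ⟨φ, hφ⟩ : ∃ φ : ∐ Z ⟶ ∐ Z, ∀ n : ℕ, (Sigma.ι Z n : Z n ⟶ ∐ Z) ≫ φ =
      (Sigma.ι Z n : Z n ⟶ ∐ Z) - b n ≫ (Sigma.ι Z (n + 1) : Z (n + 1) ⟶ ∐ Z) :=
    ⟨Sigma.desc fun n : ℕ => (Sigma.ι Z n : Z n ⟶ ∐ Z) - b n ≫ Sigma.ι Z (n + 1),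
      fun n => Sigma.ι_desc _ _⟩
  obtain ⟨V, q, e, hV⟩ := distinguished_cocone_triangle φ
  have hq : ∀ n, Sigma.ι Z n ≫ q = b n ≫ Sigma.ι Z (n + 1) ≫ q := fun n => by
    have hφq : φ ≫ q = 0 := comp_distTriang_mor_zero₁₂ _ hV
    have := congr($(hφ n) ≫ q)
    rw [Category.assoc, hφq, comp_zero, Preadditive.sub_comp, Category.assoc] at this
    exact sub_eq_zero.1 this.symm
  let p : Z 0 ⟶ V := Sigma.ι Z 0 ≫ q
  obtain ⟨U, i, d, hU⟩ := distinguished_cocone_triangle₁ p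
  refine ⟨U, V, i, p, d, hU, fun g f hg => ?_, fun F _ _ hF Y hY f => ?_⟩
  · have := (hG g hg).preservesColimitsOfShape_nat
    have hφ₀ : φ ≫ Sigma.π Z 0 = Sigma.π Z 0 := Sigma.hom_ext _ _ fun n => by
      rw [← Category.assoc, hφ, Preadditive.sub_comp, Category.assoc,
        Sigma.ι_π_of_ne Z (Nat.succ_ne_zero n), comp_zero, sub_zero]
    have hφ₁ : ∀ m, φ ≫ Sigma.π Z (m + 1) = Sigma.π Z (m + 1) - Sigma.π Z m ≫ b m :=
      fun m => Sigma.hom_ext _ _ fun n => by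
        rw [← Category.assoc, hφ, Preadditive.sub_comp, Preadditive.comp_sub, Category.assoc]
        obtain rfl | hn := eq_or_ne n m
        · simp
        · rw [Sigma.ι_π_of_ne Z (show n + 1 ≠ m + 1 by omega), ← Category.assoc,
            Sigma.ι_π_of_ne Z hn, comp_zero, zero_comp]
    have heφ : e ≫ φ⟦(1 : ℤ)⟧' = 0 := comp_distTriang_mor_zero₃₁ _ hV
    -- The components of `f ≫ e` vanish by induction: `φ⟦1⟧'` annihilates `f ≫ e`, and `φ` is the
    -- identity minus a shift of index.
    have hfe : f ≫ e = 0 := by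
      refine eq_zero_of_comp_proj_eq_zero
        (isColimitOfHasCoproductOfPreservesColimit (shiftFunctor C (1 : ℤ)) Z)
        (fun n => (Sigma.π Z n)⟦(1 : ℤ)⟧') (fun n => ?_) (fun n m hnm => ?_) g (f ≫ e) fun n => ?_
      · simp [← Functor.map_comp]
      · simp [← Functor.map_comp, Sigma.ι_π_of_ne Z hnm]
      · have hπ : ∀ n, (f ≫ e) ≫ (φ ≫ Sigma.π Z n)⟦(1 : ℤ)⟧' = 0 := fun n => by
          rw [Functor.map_comp, Category.assoc, reassoc_of% heφ, zero_comp, comp_zero]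
        induction n with
        | zero => simpa only [hφ₀] using hπ 0
        | succ n ih =>
          have := hπ (n + 1)
          rw [hφ₁, Functor.map_sub, Functor.map_comp, Preadditive.comp_sub,
            ← Category.assoc (f ≫ e), ih, zero_comp, sub_zero] at this
          exact this
    obtain ⟨k, rfl⟩ := Triangle.coyoneda_exact₃ _ hV f hfe
    -- It is enough to treat maps through one `Z n`; these die in `Z (n + 1)`, hence in `V`.
    exact mem_of_preservesColimit (coproductIsCoproduct Z) g
      (Preadditive.rightComp g q).ker (fun n k => by
        change (k ≫ Sigma.ι Z n) ≫ q = 0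
        rw [Category.assoc, hq, ← Category.assoc, (hb n).comp_eq_zero hg, zero_comp]) k
  · have : PreservesColimitsOfShape (Discrete ℕ) F :=
      have := hF (ULift.{v} ℕ)
      preservesColimitsOfShape_of_equiv (Discrete.equivalence Equiv.ulift) _
    have hc := isColimitOfHasCoproductOfPreservesColimit F Z
    have hφF : ∀ n, F.map (Sigma.ι Z n) ≫ F.map φ =
        F.map (Sigma.ι Z n) - F.map (b n) ≫ F.map (Sigma.ι Z (n + 1)) := fun n => by
      rw [← F.map_comp, hφ, F.map_sub, F.map_comp]
    have hsurj n (f : F.obj (Z n) ⟶ Y) := (hb n).exists_extension F hF hY f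
    obtain ⟨δ, hFU⟩ : ∃ δ : F.obj V ⟶ (F.obj U)⟦(1 : ℤ)⟧,
        Triangle.mk (F.map i) (F.map p) δ ∈ distTriang C := ⟨_, F.map_distinguished _ hU⟩
    obtain ⟨ε, hFV⟩ : ∃ ε, Triangle.mk (F.map φ) (F.map q) ε ∈ distTriang C :=
      ⟨_, F.map_distinguished _ hV⟩
    have hp : F.map p = F.map (Sigma.ι Z 0) ≫ F.map q := F.map_comp _ _
    have hip : F.map i ≫ F.map p = 0 := comp_distTriang_mor_zero₁₂ _ hFU
    have hpδ : F.map p ≫ δ = 0 := comp_distTriang_mor_zero₂₃ _ hFU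
    rw [hp] at hip hpδ
    have h₀ : F.map (Sigma.ι Z 0) ≫ F.map q ≫ δ ≫ f⟦(1 : ℤ)⟧' = 0 := by
      rw [← Category.assoc, ← Category.assoc, hpδ, zero_comp]
    -- The obstruction to extending `f` along `F.map i` is a map `F.obj V ⟶ Y⟦1⟧` vanishing on
    -- `F.obj (Z 0)`, hence zero. The extension `l` itself extends to `F.obj V`, so its restriction
    -- `f` to the fiber is zero.
    obtain ⟨l, rfl⟩ := exists_eq_mor₁_comp hFU f (eq_zero_of_telescope hc hφF hFV hsurj
      (fun n f hf => (hb n).eq_zero F hF hY f hf) _ h₀)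
    obtain ⟨m, rfl⟩ : ∃ m : F.obj V ⟶ Y, l = F.map (Sigma.ι Z 0) ≫ F.map q ≫ m :=
      exists_extension_telescope hc hφF hFV hsurj l
    rw [← Category.assoc (F.map (Sigma.ι Z 0)), ← Category.assoc, hip, zero_comp]

end Approximation

/-! ### Compact objects under adjunction and shift -/

section CompactAdjunction

variable {C : Type u} [Category.{v} C] [Preadditive C]

/-- Left adjoints of functors which preserve coproducts preserve compact objects. -/
lemma IsCompact.of_adjunction {L R : C ⥤ C} [L.Additive] (adj : L ⊣ R)
    (hR : ∀ J : Type v, PreservesColimitsOfShape (Discrete J) R) {X : C} (hX : IsCompact X) :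
    IsCompact (L.obj X) := fun J => by
  have := adj.right_adjoint_additive
  have := hR J
  have := hX J
  let e : R ⋙ preadditiveCoyoneda.obj (Opposite.op X) ≅
      preadditiveCoyoneda.obj (Opposite.op (L.obj X)) :=
    NatIso.ofComponents
      (fun Y => AddEquiv.toAddCommGrpIso (X := AddCommGrpCat.of (X ⟶ R.obj Y))
        (Y := AddCommGrpCat.of (L.obj X ⟶ Y)) (adj.homAddEquiv X Y).symm)
      (fun {Y Y'} f => by
        ext g
        exact adj.homEquiv_naturality_right_symm g f)
  exact preservesColimitsOfShape_of_natIso e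

instance : (IsCompact (C := C)).IsClosedUnderIsomorphisms where
  of_iso e h J :=
    have := h J
    preservesColimitsOfShape_of_natIso (preadditiveCoyoneda.mapIso e.symm.op)

lemma IsCompact.shift [HasShift C ℤ] [∀ n : ℤ, (shiftFunctor C n).Additive] {X : C}
    (hX : IsCompact X) (n : ℤ) : IsCompact (X⟦n⟧) :=
  IsCompact.of_adjunction (L := shiftFunctor C n) (R := shiftFunctor C (-n))
    (shiftEquiv C n).toAdjunction (fun _ => inferInstance) hX

end CompactAdjunction

/-! ### Rigid objects -/

section Rigid

variable {C : Type u} [Category.{v} C] [MonoidalCategory C]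

lemma IsRigid.exists_natIso {X : C} (hX : IsRigid X) :
    ∃ _ : Closed X, Nonempty (tensorLeft ((ihom X).obj (𝟙_ C)) ≅ ihom X) := by
  obtain ⟨_, h⟩ := hX
  have h' {Y Y' : C} (f : Y ⟶ Y') : (ihom X).obj (𝟙_ C) ◁ f ≫ dualTensorToIhom X Y' =
      dualTensorToIhom X Y ≫ (ihom X).map f := by
    rw [dualTensorToIhom, dualTensorToIhom, ← MonoidalClosed.curry_natural_left,
      ← MonoidalClosed.curry_natural_right, Category.assoc, Category.assoc,
      associator_inv_naturality_right_assoc, whisker_exchange_assoc]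
    congr 3
    exact leftUnitor_naturality f
  exact ⟨‹_›, ⟨NatIso.ofComponents (fun Y => @asIso _ _ _ _ _ (h Y)) h'⟩⟩

end Rigid

/-! ### Orthogonals and shifts -/

section Orthogonal

variable {C : Type u} [Category.{v} C] [Preadditive C] [HasShift C ℤ]
  [∀ n : ℤ, (shiftFunctor C n).Additive]

lemma rightOrthogonal_shift_neg_one {G : ObjectProperty C} (hG : ∀ ⦃g : C⦄, G g → G (g⟦(1 : ℤ)⟧))
    {Y : C} (hY : G.rightOrthogonal Y) : G.rightOrthogonal (Y⟦(-1 : ℤ)⟧) := fun g f hg => by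
  refine (shiftFunctor C (1 : ℤ)).map_injective ?_
  rw [Functor.map_zero, ← cancel_mono ((shiftFunctorCompIsoId C (-1 : ℤ) 1 (by simp)).hom.app Y),
    zero_comp]
  exact hY _ (hG hg)

lemma leftOrthogonal_shift_one {V : ObjectProperty C} (hV : ∀ ⦃Y : C⦄, V Y → V (Y⟦(-1 : ℤ)⟧))
    {X : C} (hX : V.leftOrthogonal X) : V.leftOrthogonal (X⟦(1 : ℤ)⟧) := fun Y f hY => by
  refine (shiftFunctor C (-1 : ℤ)).map_injective ?_
  rw [Functor.map_zero, ← cancel_epi ((shiftFunctorCompIsoId C (1 : ℤ) (-1) (by simp)).inv.app X),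
    comp_zero]
  exact hX _ (hV hY)

end Orthogonal

/-! ### The t-structure generated by compact objects -/

section TStructure

variable {C : Type u} [Category.{v} C] [Preadditive C] [HasZeroObject C] [HasShift C ℤ]
  [∀ n : ℤ, (shiftFunctor C n).Additive] [Pretriangulated C]

lemma aisle_eq_leftOrthogonal (τ : TStructure C) : aisle τ = (coaisle τ).leftOrthogonal := by
  ext X
  refine ⟨fun hX Y f hY => τ.zero' f hX hY, fun hX => ?_⟩
  have := (τ.isLE_iff_orthogonal 0 1 rfl X).2 fun Y f hY => hX f hY.ge
  exact this.le

lemma coaisle_eq_rightOrthogonal (τ : TStructure C) : coaisle τ = (aisle τ).rightOrthogonal := by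
  ext X
  refine ⟨fun hX Y f hY => τ.zero' f hY hX, fun hX => ?_⟩
  have := (τ.isGE_iff_orthogonal 0 1 rfl X).2 fun Y f hY => hX f hY.le
  exact this.ge

lemma aisle_shift_one (t : TStructure C) {X : C} (hX : aisle t X) : aisle t (X⟦(1 : ℤ)⟧) :=
  t.le_monotone (show (-1 : ℤ) ≤ 0 by lia) _ (t.le_shift 0 1 (-1) (by lia) X hX)

/-- The t-structure generated by a class of compact objects which is essentially small and
closed under suspension. -/
def tStructureOfCompact [HasCoproducts.{v} C] (G : ObjectProperty C)
    [ObjectProperty.EssentiallySmall.{v} G] (hG : G ≤ IsCompact)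
    (hG' : ∀ ⦃g : C⦄, G g → G (g⟦(1 : ℤ)⟧)) : TStructure C where
  le n := G.rightOrthogonal.leftOrthogonal.shift n
  -- The index is `n - 1` because the coaisle is `ge 1`, not `ge 0`.
  ge n := G.rightOrthogonal.shift (n - 1)
  le_shift n a n' h X hX :=
    G.rightOrthogonal.leftOrthogonal.prop_of_iso ((shiftFunctorAdd' C a n' n h).app X) hX
  ge_shift n a n' h X hX := G.rightOrthogonal.prop_of_iso
    ((shiftFunctorAdd' C a (n' - 1) (n - 1) (by lia)).app X) hX
  zero' X Y f hX hY :=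
    G.rightOrthogonal.leftOrthogonal.prop_of_iso ((shiftFunctorZero C ℤ).app X) hX f
      (G.rightOrthogonal.prop_of_iso ((shiftFunctorZero C ℤ).app Y) hY)
  le_zero_le X hX := leftOrthogonal_shift_one (V := G.rightOrthogonal)
    (fun _ => rightOrthogonal_shift_neg_one hG')
    (G.rightOrthogonal.leftOrthogonal.prop_of_iso ((shiftFunctorZero C ℤ).app X) hX)
  ge_one_le X hX := rightOrthogonal_shift_neg_one hG'
    (G.rightOrthogonal.prop_of_iso ((shiftFunctorZero C ℤ).app X) hX)
  exists_triangle_zero_one A := by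
    obtain ⟨U, V, i, p, d, hT, hV, hU⟩ := exists_approximation G hG A
    have hU' : G.rightOrthogonal.leftOrthogonal U := fun Y f hY =>
      hU (𝟭 C) (fun _ => inferInstance) Y (fun g hg f => hY f hg) f
    exact ⟨U, V,
      G.rightOrthogonal.leftOrthogonal.prop_of_iso ((shiftFunctorZero C ℤ).symm.app U) hU',
      G.rightOrthogonal.prop_of_iso ((shiftFunctorZero C ℤ).symm.app V) hV, i, p, d, hT⟩

variable [HasCoproducts.{v} C] {G : ObjectProperty C}
  [ObjectProperty.EssentiallySmall.{v} G] (hG : G ≤ IsCompact)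

lemma coaisle_tStructureOfCompact (hG' : ∀ ⦃g : C⦄, G g → G (g⟦(1 : ℤ)⟧)) :
    coaisle (tStructureOfCompact G hG hG') = G.rightOrthogonal := by
  ext X
  exact G.rightOrthogonal.prop_iff_of_iso ((shiftFunctorZero C ℤ).app X)

include hG in
/-- An exact functor which preserves coproducts maps objects generated by a class `G` of compact
objects to objects with no nonzero morphism to `Y`, if it does so for objects of `G`. -/
lemma eq_zero_of_leftOrthogonal (F : C ⥤ C) [F.CommShift ℤ] [F.IsTriangulated]
    (hF : ∀ J : Type v, PreservesColimitsOfShape (Discrete J) F) {Y : C}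
    (hY : ∀ ⦃g : C⦄, G g → ∀ f : F.obj g ⟶ Y, f = 0) {X : C}
    (hX : G.rightOrthogonal.leftOrthogonal X) (f : F.obj X ⟶ Y) : f = 0 := by
  obtain ⟨U, V, i, p, d, hT, hV, hU⟩ := exists_approximation G hG X
  -- The map `p` is zero, so `X` is a retract of `U`.
  obtain ⟨r, hr⟩ : ∃ r : X ⟶ U, 𝟙 X = r ≫ i :=
    Triangle.coyoneda_exact₂ _ hT (𝟙 X) (hX _ hV)
  rw [← Category.id_comp f, ← F.map_id, hr, F.map_comp, Category.assoc,
    hU F hF Y hY (F.map i ≫ f), comp_zero]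

end TStructure

/-! ### Tensor t-structures and their coaisles -/

section Tensor

variable {C : Type u} [Category.{v} C] [Preadditive C] [HasZeroObject C] [HasShift C ℤ]
  [∀ n : ℤ, (shiftFunctor C n).Additive] [Pretriangulated C]
  [MonoidalCategory C]

lemma IsBigTT.additive_tensorLeft (h : IsBigTT C) (X : C) : (tensorLeft X).Additive := by
  obtain ⟨_, _⟩ := h.tensor_exact X
  infer_instance

/-- The objects `c ⊗ s` for `c` compact in the aisle of `t`, and `s` in `S`. -/
def tensorGenerators (t : TStructure C) (S : ObjectProperty C) : ObjectProperty C := fun Z =>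
  ∃ c s : C, aisle t c ∧ IsCompact c ∧ S s ∧ Nonempty (Z ≅ c ⊗ s)

lemma rightOrthogonal_tensorGenerators_iff (t : TStructure C) (S : ObjectProperty C) (Y : C) :
    (tensorGenerators t S).rightOrthogonal Y ↔
      ∀ c s : C, aisle t c → IsCompact c → S s → ∀ f : c ⊗ s ⟶ Y, f = 0 := by
  refine ⟨fun hY c s hc hc' hs f => hY f ⟨c, s, hc, hc', hs, ⟨Iso.refl _⟩⟩, ?_⟩
  rintro hY Z f ⟨c, s, hc, hc', hs, ⟨e⟩⟩
  rw [← cancel_epi e.inv, comp_zero]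
  exact hY c s hc hc' hs _

lemma IsTensorGeneratedBy.coaisle_eq {t : TStructure C} {S : ObjectProperty C}
    {τ τ' : TStructure C} (h : IsTensorGeneratedBy t S τ) (h' : IsTensorGeneratedBy t S τ') :
    coaisle τ = coaisle τ' := by
  rw [coaisle_eq_rightOrthogonal, coaisle_eq_rightOrthogonal,
    le_antisymm (h.minimal τ' h'.isTensor h'.subset_aisle)
      (h'.minimal τ h.isTensor h.subset_aisle)]

/-- A compactly generated `⊗`-t-structure is generated by the compact objects of its aisle. -/
lemma IsCompactlyGenerated.isTensorGeneratedBy {t τ : TStructure C} (h : IsCompactlyGenerated τ)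
    (hτ : IsTensorTStructure t τ) : IsTensorGeneratedBy t (aisle τ ⊓ IsCompact) τ where
  isTensor := hτ
  subset_aisle := inf_le_left
  minimal τ' _ hS := by
    rw [aisle_eq_leftOrthogonal τ, aisle_eq_leftOrthogonal τ', h]
    exact fun X hX Y f hY => hX f fun Z g hZ => τ'.zero' g (hS Z hZ) hY

/-- The right adjoint of `X ⊗ -` is `X^* ⊗ -`, which preserves coproducts. -/
lemma IsBigTT.isCompact_tensor (h : IsBigTT C) {X Y : C} (hX : IsCompact X)
    (hY : IsCompact Y) : IsCompact (X ⊗ Y) := by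
  obtain ⟨_, ⟨e⟩⟩ := ((h.compact_iff_rigid X).1 hX).exists_natIso
  have := h.additive_tensorLeft X
  refine IsCompact.of_adjunction (ihom.adjunction X) (fun J => ?_) hY
  have := h.tensor_coproducts ((ihom X).obj (𝟙_ C)) J
  exact preservesColimitsOfShape_of_natIso e

variable [SymmetricCategory C]

namespace IsBigTTT

variable {t : TStructure C} (ht : IsBigTTT t) {S : ObjectProperty C} (hS : S ≤ IsCompact)

include ht

lemma coaisle_ihom_iff (s : C) [Closed s] (Y : C) :
    coaisle t ((ihom s).obj Y) ↔ ∀ c, aisle t c → IsCompact c → ∀ f : c ⊗ s ⟶ Y, f = 0 := by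
  have := ht.isBigTT.additive_tensorLeft s
  have hz (c : C) : (ihom.adjunction s).homEquiv c Y 0 = 0 :=
    (ihom.adjunction s).homAddEquiv_zero c Y
  rw [ht.isCompactlyGenerated]
  refine ⟨fun h c hc hc' f => ?_, fun h c f hc => ?_⟩
  · rw [← cancel_epi (β_ s c).hom, comp_zero]
    exact ((ihom.adjunction s).homEquiv c Y).injective ((h _ ⟨hc, hc'⟩).trans (hz c).symm)
  · obtain ⟨g, rfl⟩ := ((ihom.adjunction s).homEquiv c Y).surjective f
    have hg : (β_ c s).hom ≫ g = 0 := h c hc.1 hc.2 _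
    rw [← comp_zero (f := (β_ c s).hom), cancel_epi] at hg
    rw [hg, hz]

include hS

lemma tensorGenerators_le : tensorGenerators t S ≤ IsCompact := by
  rintro Z ⟨c, s, hc, hc', hs, ⟨e⟩⟩
  exact ObjectProperty.prop_of_iso _ e.symm (ht.isBigTT.isCompact_tensor hc' (hS s hs))

lemma essentiallySmall_tensorGenerators :
    ObjectProperty.EssentiallySmall.{v} (tensorGenerators t S) :=
  have := ht.isBigTT.essentiallySmall_compact
  .of_le (ht.tensorGenerators_le hS)

lemma ihomClass_eq : ihomClass t S = (tensorGenerators t S).rightOrthogonal := by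
  ext Y
  rw [rightOrthogonal_tensorGenerators_iff]
  refine ⟨fun h c s hc hc' hs f => ?_, fun h s hs => ?_⟩
  · obtain ⟨_, hY⟩ := h s hs
    exact (ht.coaisle_ihom_iff s Y).1 hY c hc hc' f
  · obtain ⟨_, _⟩ := (ht.isBigTT.compact_iff_rigid s).1 (hS s hs)
    exact ⟨‹_›, (ht.coaisle_ihom_iff s Y).2 fun c hc hc' => h c s hc hc' hs⟩

lemma semiBousfieldClass_dualClass_eq :
    semiBousfieldClass t (dualClass S) = (tensorGenerators t S).rightOrthogonal := by
  ext Y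
  rw [rightOrthogonal_tensorGenerators_iff]
  refine ⟨fun h c s hc hc' hs f => ?_, ?_⟩
  · obtain ⟨_, ⟨e⟩⟩ := ((ht.isBigTT.compact_iff_rigid s).1 (hS s hs)).exists_natIso
    exact (ht.coaisle_ihom_iff s Y).1 (ObjectProperty.prop_of_iso (t.ge 1) (e.app Y)
      (h _ ⟨s, hs, ‹_›, ⟨Iso.refl _⟩⟩)) c hc hc' f
  · rintro h D ⟨s, hs, hcl, ⟨i⟩⟩
    obtain ⟨hcl', ⟨e⟩⟩ := ((ht.isBigTT.compact_iff_rigid s).1 (hS s hs)).exists_natIso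
    -- The dual `D` may be formed with another choice of right adjoint; uniqueness of adjoints
    -- compares the two.
    let j : D ≅ (@ihom _ _ _ s hcl').obj (𝟙_ C) :=
      i ≪≫ ((@ihom.adjunction _ _ _ s hcl).rightAdjointUniq
        (@ihom.adjunction _ _ _ s hcl')).app (𝟙_ C)
    exact ObjectProperty.prop_of_iso (t.ge 1) (whiskerRightIso j Y ≪≫ e.app Y).symm
      ((ht.coaisle_ihom_iff s Y).2 fun c hc hc' => h c s hc hc' hs)

/-- The `⊗`-t-structure generated by a class of compact objects exists, and its coaisle is the
right orthogonal of the objects `c ⊗ s`. -/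
theorem exists_isTensorGeneratedBy :
    ∃ τ : TStructure C, IsTensorGeneratedBy t S τ ∧ IsCompactlyGenerated τ ∧
      coaisle τ = (tensorGenerators t S).rightOrthogonal := by
  have hb := ht.isBigTT
  have := hb.hasCoproducts
  have := hb.essentiallySmall_compact
  have := ht.essentiallySmall_tensorGenerators hS
  have hG := ht.tensorGenerators_le hS
  -- Exactness of `s ⊗ -` gives `(c ⊗ s)⟦1⟧ ≅ c⟦1⟧ ⊗ s`.
  have hG' : ∀ ⦃g : C⦄, tensorGenerators t S g → tensorGenerators t S (g⟦(1 : ℤ)⟧) := by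
    rintro Z ⟨c, s, hc, hc', hs, ⟨e⟩⟩
    obtain ⟨_, _⟩ := hb.tensor_exact s
    exact ⟨c⟦(1 : ℤ)⟧, s, aisle_shift_one t hc, hc'.shift 1, hs,
      ⟨(shiftFunctor C (1 : ℤ)).mapIso (e ≪≫ β_ c s) ≪≫
        (((tensorLeft s).commShiftIso (1 : ℤ)).app c).symm ≪≫ β_ s (c⟦(1 : ℤ)⟧)⟩⟩
  let τ := tStructureOfCompact (tensorGenerators t S) hG hG'
  have hτ : coaisle τ = (tensorGenerators t S).rightOrthogonal :=
    coaisle_tStructureOfCompact hG hG'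
  have hGτ : tensorGenerators t S ≤ aisle τ := fun Z hZ => by
    rw [aisle_eq_leftOrthogonal, hτ]
    exact fun Y f hY => hY f hZ
  refine ⟨τ, ⟨fun X U hX hU => ?_, fun s hs => ?_, fun τ' hτ' hSτ' => ?_⟩, ?_, hτ⟩
  · rw [aisle_eq_leftOrthogonal] at hU ⊢
    intro Y f hY
    have hYτ := hY
    rw [hτ, rightOrthogonal_tensorGenerators_iff] at hY
    obtain ⟨_, _⟩ := hb.tensor_exact U
    have hX' : (aisle t ⊓ IsCompact).rightOrthogonal.leftOrthogonal X := by
      rw [aisle_eq_leftOrthogonal, ht.isCompactlyGenerated] at hX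
      exact hX
    have : ObjectProperty.EssentiallySmall.{v} (aisle t ⊓ IsCompact) := .of_le inf_le_right
    rw [← cancel_epi (β_ U X).hom, comp_zero]
    -- Since `U ⊗ -` is exact and preserves coproducts, `X` may be replaced by a compact object `c`
    -- of `T^{≤ 0}`.
    refine eq_zero_of_leftOrthogonal (G := aisle t ⊓ IsCompact) inf_le_right (tensorLeft U)
      (hb.tensor_coproducts U) (fun c hc g => ?_) hX' _
    obtain ⟨_, _⟩ := (hb.compact_iff_rigid c).1 hc.2
    have := hb.additive_tensorLeft c
    rw [← cancel_epi (β_ c U).hom, comp_zero]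
    -- It suffices that `[c, Y]` lies in the coaisle: a map `c' ⊗ s ⟶ [c, Y]` corresponds to a map
    -- `(c ⊗ c') ⊗ s ⟶ Y`, and `c ⊗ c'` is again compact in `T^{≤ 0}`.
    refine ((ihom.adjunction c).homEquiv U Y).injective ?_
    refine Eq.trans (hU _ ?_) ((ihom.adjunction c).homAddEquiv_zero U Y).symm
    rw [hτ, rightOrthogonal_tensorGenerators_iff]
    intro c' s hc' hc'' hs k
    obtain ⟨k, rfl⟩ := ((ihom.adjunction c).homEquiv _ Y).surjective k
    have hk : (α_ c c' s).hom ≫ k = 0 := hY (c ⊗ c') s (ht.tensor_mem _ _ hc.1 hc')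
      (hb.isCompact_tensor hc.2 hc'') hs _
    rw [← comp_zero (f := (α_ c c' s).hom), cancel_epi] at hk
    rw [hk]
    exact (ihom.adjunction c).homAddEquiv_zero _ Y
  · exact hGτ _ ⟨𝟙_ C, s, ht.unit_mem, hb.compact_unit, hs, ⟨(λ_ s).symm⟩⟩
  · rw [aisle_eq_leftOrthogonal τ, aisle_eq_leftOrthogonal τ', hτ]
    refine fun X hX Y f hY => hX f ?_
    rw [rightOrthogonal_tensorGenerators_iff]
    exact fun c s hc _ hs g => τ'.zero' g (hτ' c s hc (hSτ' s hs)) hY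
  · refine le_antisymm (fun Y hY Z f hZ => τ.zero' f hZ.1 hY) fun Y hY => ?_
    rw [hτ]
    exact fun Z f hZ => hY f ⟨hGτ Z hZ, hG Z hZ⟩

end IsBigTTT

end Tensor

end BigTT

/-! ### The main theorem -/

open BigTT in
theorem lemma1p11 {C : Type u} [Category.{v} C] [Preadditive C] [HasZeroObject C] [HasShift C ℤ]
    [∀ n : ℤ, (shiftFunctor C n).Additive] [Pretriangulated C]
    [MonoidalCategory C] [SymmetricCategory C]
    (t : TStructure C) (ht : BigTT.IsBigTTT t) :
    (∀ S : ObjectProperty C, S ≤ BigTT.IsCompact → ∀ V : ObjectProperty C,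
      List.TFAE [
        ∃ τ : TStructure C, BigTT.IsTensorGeneratedBy t S τ ∧ BigTT.IsCompactlyGenerated τ ∧
          V = BigTT.coaisle τ,
        V = BigTT.ihomClass t S,
        V = BigTT.semiBousfieldClass t (BigTT.dualClass S)]) ∧
    (∀ τ : TStructure C, BigTT.IsTensorTStructure t τ → BigTT.IsCompactlyGenerated τ →
      BigTT.IsSemiBousfieldClass t (BigTT.coaisle τ)) := by
  refine ⟨fun S hS V => ?_, fun τ hτ hτ' => ⟨dualClass (aisle τ ⊓ IsCompact), ?_⟩⟩
  · obtain ⟨τ, h₁, h₂, h₃⟩ := ht.exists_isTensorGeneratedBy hS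
    rw [ht.ihomClass_eq hS, ht.semiBousfieldClass_dualClass_eq hS]
    tfae_have 1 → 2 := by
      rintro ⟨τ', h₁', -, rfl⟩
      rw [h₁'.coaisle_eq h₁, h₃]
    tfae_have 2 → 1 := by
      rintro rfl
      exact ⟨τ, h₁, h₂, h₃.symm⟩
    tfae_have 2 ↔ 3 := Iff.rfl
    tfae_finish
  · obtain ⟨τ', h₁, -, h₃⟩ :=
      ht.exists_isTensorGeneratedBy (S := aisle τ ⊓ IsCompact) inf_le_right
    rw [(hτ'.isTensorGeneratedBy hτ).coaisle_eq h₁, h₃,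
      ht.semiBousfieldClass_dualClass_eq inf_le_right]
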